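/- All graphs are finite, simple and undirected. For a graph $G$, let $F(G)$ denote the number of connected subgraphs of $G$ (not necessarily induced, each with at least one vertex). A unicyclic graph on $n$ vertices is a connected graph with $n$ vertices and $n$ edges, and the girth of a graph is the length of a shortest cycle in it. For $3\le g<n$, let $U^l_{n,g}$ denote the lollipop graph on $n$ vertices, obtained from the cycle $C_g$ and a path on $n-g+1$ vertices by identifying one end vertex of the path with one vertex of the cycle. **Theorem.** Let $3\le g<n$. The graph $U^l_{n,g}$ is a unicyclic graph on $n$ vertices with girth $g$. For every unicyclic graph $G$ on $n$ vertices with girth $g$, $$F(G)\ge F(U^l_{n,g}),$$ with equality if and only if $G$ is isomorphic to $U^l_{n,g}$. Moreover, $$F(U^l_{n,g})=\left(\frac{n-g}{2}\right)(n+g^2+3)+g^2+1.$$ -/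

import Mathlib

namespace SimpleGraph

/-- The core index `F(G)` of a graph: the number of its connected subgraphs. A subgraph is a set of
vertices with a set of edges of `G` between them (not necessarily induced); a connected subgraph has
at least one vertex. -/
noncomputable def coreIndex {V : Type*} (G : SimpleGraph V) : ℕ :=
  {H : G.Subgraph | H.Connected}.ncard

/-- `G` is a unicyclic graph on `n` vertices with girth `g`: a connected graph with `n` vertices and
`n` edges whose shortest cycle has length `g`. -/
structure IsUnicyclicWithGirth {V : Type*} [Finite V] (G : SimpleGraph V) (n g : ℕ) : Prop where
  connected : G.Connected
  card_verts : Nat.card V = n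
  card_edges : G.edgeSet.ncard = n
  girth_eq : G.girth = g

/-- The lollipop on the vertices `0, …, n - 1` (used for `3 ≤ g < n`): the cycle
`0, 1, …, g - 1, 0` together with the path `g - 1, g, …, n - 1`, which starts at the cycle vertex
`g - 1` and has `n - g + 1` vertices. -/
def lollipop (n g : ℕ) : SimpleGraph (Fin n) :=
  SimpleGraph.fromRel fun i j : Fin n =>
    i.val + 1 = j.val ∨ (i.val = 0 ∧ j.val + 1 = g)

end SimpleGraph

/-! Edge counting shows that a connected graph with n vertices and n edges is an induced cycle on
which vertices are hung one at a time, each adjacent to exactly one earlier vertex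
(`IsUnicyclicWithGirth.exists_leafGrowth`). So F can be followed along this growth.

Let c(u) be the number of connected subgraphs through u. When v is hung on w, a connected subgraph
through v is v alone, or one through w with the edge vw added. Hence c(v) = c(w) + 1, and F grows by
c(w) + 1. For every older u, c(u) grows by at least 2, because two different connected subgraphs
span the old vertices: the cycle, or the cycle less an edge, each with all pendant edges. So the
least possible value of c rises by 1 per step, and it is attained only by hanging each vertex on the
one before, which builds the lollipop (`LeafGrowth.lollipopEndCount_le`). Summing the growth of F
gives the bound and its equality case (`LeafGrowth.lollipopCount_le`).

The start is the cycle: its connected subgraphs are g² arcs and the cycle itself, of which g(g+1)/2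
+ 1 pass through a given vertex. -/

namespace SimpleGraph

variable {V : Type*} {G : SimpleGraph V}

/-! ### Connectedness through chains of adjacent vertices -/

namespace Subgraph

lemma reachable_coe_iff {H : G.Subgraph} (x y : H.verts) :
    H.coe.Reachable x y ↔ Relation.ReflTransGen H.Adj x y := by
  constructor
  · intro h
    rw [reachable_iff_reflTransGen] at h
    exact h.lift Subtype.val fun _ _ hab => hab
  · obtain ⟨x, hx⟩ := x
    obtain ⟨y, hy⟩ := y
    intro h
    change Relation.ReflTransGen H.Adj x y at h
    induction h with
    | refl => rfl
    | @tail b c hb hbc ih =>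
      refine (ih hbc.fst_mem).trans ?_
      exact Adj.reachable (G := H.coe) hbc

/-- Chains in `V` avoid the subtype `H.verts`, so subgraphs with different vertex sets can be
compared. -/
lemma connected_iff_reflTransGen {H : G.Subgraph} :
    H.Connected ↔ H.verts.Nonempty ∧
      ∀ x ∈ H.verts, ∀ y ∈ H.verts, Relation.ReflTransGen H.Adj x y := by
  rw [Subgraph.connected_iff, Subgraph.preconnected_iff, and_comm]
  refine and_congr_right fun _ => ⟨fun h x hx y hy => ?_, fun h x y => ?_⟩
  · exact (reachable_coe_iff ⟨x, hx⟩ ⟨y, hy⟩).1 (h _ _)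
  · exact (reachable_coe_iff x y).2 (h _ x.2 _ y.2)

lemma connected_of_root {H : G.Subgraph} {r : V} (hr : r ∈ H.verts)
    (h : ∀ x ∈ H.verts, Relation.ReflTransGen H.Adj r x) : H.Connected := by
  refine connected_iff_reflTransGen.2 ⟨⟨r, hr⟩, fun x hx y hy => ?_⟩
  have hs : Std.Symm H.Adj := ⟨fun _ _ h => h.symm⟩
  exact (Relation.ReflTransGen.stdSymm.symm _ _ (h x hx)).trans (h y hy)

/-- A set of vertices meeting a connected subgraph and closed under its adjacency contains all its
vertices. -/
lemma Connected.verts_subset_of_closed {H : G.Subgraph} (hH : H.Connected) {A : Set V} {r : V}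
    (hr : r ∈ H.verts) (hrA : r ∈ A) (hA : ∀ x ∈ A, ∀ y, H.Adj x y → y ∈ A) : H.verts ⊆ A := by
  intro y hy
  have h := (connected_iff_reflTransGen.1 hH).2 r hr y hy
  induction h with
  | refl => exact hrA
  | tail _ hbc ih => exact hA _ (ih hbc.fst_mem) _ hbc

end Subgraph

/-! ### Connected subgraphs and pendant vertices -/

/-- The connected subgraphs of `G` with all vertices in `S`. -/
def connectedIn (G : SimpleGraph V) (S : Set V) : Set G.Subgraph :=
  {H | H.Connected ∧ H.verts ⊆ S}

/-- The connected subgraphs of `G` with all vertices in `S` that contain `u`. -/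
def connectedThrough (G : SimpleGraph V) (S : Set V) (u : V) : Set G.Subgraph :=
  {H | H.Connected ∧ H.verts ⊆ S ∧ u ∈ H.verts}

lemma coreIndex_eq_ncard_connectedIn_univ : G.coreIndex = (G.connectedIn Set.univ).ncard := by
  simp [coreIndex, connectedIn]

/-- `v` is a new vertex whose only neighbour in `S` is `w`. -/
structure IsPendant (G : SimpleGraph V) (S : Set V) (v w : V) : Prop where
  notMem : v ∉ S
  mem : w ∈ S
  adj_iff : ∀ x ∈ S, G.Adj v x ↔ x = w

namespace IsPendant

variable {S : Set V} {v w : V}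

lemma adj (h : G.IsPendant S v w) : G.Adj w v := ((h.adj_iff w h.mem).2 rfl).symm

/-- Attach a pendant edge to a subgraph. -/
def attach (h : G.IsPendant S v w) (H : G.Subgraph) : G.Subgraph := H ⊔ G.subgraphOfAdj h.adj

lemma attach_connected (h : G.IsPendant S v w) {H : G.Subgraph} (hH : H.Connected)
    (hw : w ∈ H.verts) : (h.attach H).Connected := by
  apply Subgraph.connected_sup hH.preconnected (Subgraph.subgraphOfAdj_connected h.adj).preconnected
  exact ⟨w, hw, by simp⟩

lemma verts_attach (h : G.IsPendant S v w) {H : G.Subgraph} (hw : w ∈ H.verts) :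
    (h.attach H).verts = insert v H.verts := by
  ext x
  simp only [attach, Subgraph.verts_sup, subgraphOfAdj_verts, Set.mem_union, Set.mem_insert_iff,
    Set.mem_singleton_iff]
  grind

lemma deleteVerts_attach (h : G.IsPendant S v w) {H : G.Subgraph} (hw : w ∈ H.verts)
    (hv : v ∉ H.verts) : (h.attach H).deleteVerts {v} = H := by
  ext x y
  · rw [Subgraph.deleteVerts_verts, h.verts_attach hw]
    grind
  · rw [Subgraph.deleteVerts_adj, h.verts_attach hw]
    simp only [attach, Subgraph.sup_adj, subgraphOfAdj_adj]
    constructor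
    · rintro ⟨_, h1, _, h2, h3 | h3⟩
      · exact h3
      · simp at h1 h2 h3
        grind
    · intro hxy
      have h1 : x ∈ H.verts := hxy.fst_mem
      have h2 : y ∈ H.verts := hxy.snd_mem
      refine ⟨by simp [h1], ?_, by simp [h2], ?_, Or.inl hxy⟩
      · rintro rfl; exact hv h1
      · rintro rfl; exact hv h2

lemma attach_injOn (h : G.IsPendant S v w) : Set.InjOn h.attach (G.connectedThrough S w) := by
  intro H hH K hK hHK
  rw [← h.deleteVerts_attach hH.2.2 fun hv => h.notMem (hH.2.1 hv), hHK,
    h.deleteVerts_attach hK.2.2 fun hv => h.notMem (hK.2.1 hv)]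

/-- The only edge that can leave `v` in `H` is vw. If `H` is not the single point `v`, it contains
this edge, and removing `v` loses nothing else. -/
lemma connected_deleteVerts (h : G.IsPendant S v w) {H : G.Subgraph} (hH : H.Connected)
    (hS : H.verts ⊆ insert v S) (hv : v ∈ H.verts) (hne : H ≠ G.singletonSubgraph v) :
    H.deleteVerts {v} ∈ G.connectedThrough S w ∧ h.attach (H.deleteVerts {v}) = H := by
  have hnb : ∀ y, H.Adj v y → y = w := by
    intro y hy
    have := hS hy.snd_mem
    have hyv : y ≠ v := hy.adj_sub.ne'
    exact (h.adj_iff y (by grind)).1 hy.adj_sub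
  have hvw : v ≠ w := h.adj.ne'
  have hHvw : H.Adj v w := by
    by_contra hcon
    apply hne
    have hno : ∀ y, ¬ H.Adj v y := fun y hy => hcon (hnb y hy ▸ hy)
    have hsub : H.verts ⊆ {v} :=
      hH.verts_subset_of_closed hv rfl (by rintro x rfl y hy; exact (hno y hy).elim)
    ext x y
    · simp only [singletonSubgraph_verts, Set.mem_singleton_iff]
      exact ⟨fun hx => hsub hx, fun hx => hx ▸ hv⟩
    · simp only [singletonSubgraph_adj, Pi.bot_apply, Prop.bot_eq_false, iff_false]
      intro hxy
      have : x = v := hsub hxy.fst_mem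
      exact hno y (this ▸ hxy)
  have hw : w ∈ H.verts := hHvw.snd_mem
  refine ⟨⟨?_, ?_, ?_⟩, ?_⟩
  · have hw' : w ∈ (H.deleteVerts {v}).verts := by simp [hw, hvw.symm]
    refine Subgraph.connected_of_root hw' fun x hx => ?_
    -- A chain from `w` can enter and leave `v` only through `w`; reading each visit to `v` as a
    -- stay at `w` gives a chain that avoids `v`.
    have key : ∀ y, Relation.ReflTransGen H.Adj w y →
        Relation.ReflTransGen (H.deleteVerts {v}).Adj w (open Classical in if y = v then w else y) := by
      intro y hy
      induction hy with
      | refl => simp [hvw.symm]; rfl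
      | @tail b c hb hbc ih =>
        by_cases hbv : b = v
        · subst hbv
          rw [hnb c hbc]
          simp [hvw.symm]; rfl
        · by_cases hcv : c = v
          · subst hcv
            simp; rfl
          · simp only [hbv, hcv, if_false] at ih ⊢
            refine ih.tail ?_
            rw [Subgraph.deleteVerts_adj]
            exact ⟨hbc.fst_mem, hbv, hbc.snd_mem, hcv, hbc⟩
    have hx2 : x ≠ v := by simpa using hx.2
    simpa [hx2] using key x ((Subgraph.connected_iff_reflTransGen.1 hH).2 w hw x hx.1)
  · intro x hx
    have := hS hx.1
    have hx2 : x ≠ v := by simpa using hx.2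
    grind
  · simp [hw, hvw.symm]
  · ext x y
    · rw [h.verts_attach (by simp [hw, hvw.symm])]
      simp only [Subgraph.deleteVerts_verts, Set.mem_insert_iff, Set.mem_sdiff,
        Set.mem_singleton_iff]
      grind
    · simp only [attach, Subgraph.sup_adj, subgraphOfAdj_adj, Subgraph.deleteVerts_adj]
      constructor
      · rintro (h1 | h1)
        · exact h1.2.2.2.2
        · rcases Sym2.eq_iff.1 h1 with ⟨rfl, rfl⟩ | ⟨rfl, rfl⟩
          exacts [hHvw.symm, hHvw]
      · intro hxy
        by_cases hxv : x = v
        · subst hxv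
          rw [hnb y hxy]
          exact Or.inr Sym2.eq_swap
        · by_cases hyv : y = v
          · subst hyv
            rw [hnb x hxy.symm]
            exact Or.inr rfl
          · exact Or.inl ⟨hxy.fst_mem, hxv, hxy.snd_mem, hyv, hxy⟩

lemma connectedThrough_insert_self (h : G.IsPendant S v w) :
    G.connectedThrough (insert v S) v =
      insert (G.singletonSubgraph v) (h.attach '' G.connectedThrough S w) := by
  ext H
  constructor
  · rintro ⟨hH, hS, hv⟩
    by_cases hne : H = G.singletonSubgraph v
    · exact Or.inl hne
    · obtain ⟨h1, h2⟩ := h.connected_deleteVerts hH hS hv hne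
      exact Or.inr ⟨_, h1, h2⟩
  · rintro (rfl | ⟨K, ⟨hK, hKS, hwK⟩, rfl⟩)
    · exact ⟨Subgraph.singletonSubgraph_connected, by simp, by simp⟩
    · refine ⟨h.attach_connected hK hwK, ?_, ?_⟩ <;> rw [h.verts_attach hwK]
      · exact Set.insert_subset_insert hKS
      · simp

lemma _root_.SimpleGraph.connectedIn_insert (S : Set V) (v : V) :
    G.connectedIn (insert v S) = G.connectedIn S ∪ G.connectedThrough (insert v S) v := by
  ext H
  constructor
  · rintro ⟨hH, hS⟩
    by_cases hv : v ∈ H.verts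
    · exact Or.inr ⟨hH, hS, hv⟩
    · exact Or.inl ⟨hH, fun x hx => by have := hS hx; grind⟩
  · rintro (⟨hH, hS⟩ | ⟨hH, hS, -⟩)
    · exact ⟨hH, hS.trans (Set.subset_insert _ _)⟩
    · exact ⟨hH, hS⟩

lemma ncard_connectedThrough_insert_self [Finite V] (h : G.IsPendant S v w) :
    (G.connectedThrough (insert v S) v).ncard = (G.connectedThrough S w).ncard + 1 := by
  rw [h.connectedThrough_insert_self, Set.ncard_insert_of_notMem _ (Set.toFinite _),
    h.attach_injOn.ncard_image]
  rintro ⟨K, ⟨hK, hKS, hwK⟩, hKv⟩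
  have hw : w ∈ (h.attach K).verts := by rw [h.verts_attach hwK]; exact Or.inr hwK
  rw [hKv] at hw
  exact h.adj.ne (by simpa using hw)

/-- The increase depends only on the count through `w`, so minimising the total reduces to
minimising the count through one vertex. -/
lemma ncard_connectedIn_insert [Finite V] (h : G.IsPendant S v w) :
    (G.connectedIn (insert v S)).ncard =
      (G.connectedIn S).ncard + ((G.connectedThrough S w).ncard + 1) := by
  rw [connectedIn_insert, Set.ncard_union_eq _ (Set.toFinite _) (Set.toFinite _),
    h.ncard_connectedThrough_insert_self]
  rw [Set.disjoint_left]
  exact fun H h1 h2 => h.notMem (h1.2 h2.2.2)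

/-- A pendant vertex off `u` adds at least two connected subgraphs through `u`, as soon as two
connected subgraphs inside `S` contain `u` and the neighbour of the pendant vertex. -/
lemma ncard_connectedThrough_add_two_le [Finite V] (h : G.IsPendant S v w) {u : V}
    {H K : G.Subgraph} (hHK : H ≠ K)
    (hH : H ∈ G.connectedThrough S w) (hK : K ∈ G.connectedThrough S w)
    (huH : u ∈ H.verts) (huK : u ∈ K.verts) :
    (G.connectedThrough S u).ncard + 2 ≤ (G.connectedThrough (insert v S) u).ncard := by
  rw [← Set.ncard_pair fun he => hHK (h.attach_injOn hH hK he),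
    ← Set.ncard_union_eq _ (Set.toFinite _) (Set.toFinite _)]
  · refine Set.ncard_le_ncard ?_ (Set.toFinite _)
    rintro L (⟨h1, h2, h3⟩ | rfl | rfl)
    · exact ⟨h1, h2.trans (Set.subset_insert _ _), h3⟩
    · refine ⟨h.attach_connected hH.1 hH.2.2, ?_, ?_⟩ <;> rw [h.verts_attach hH.2.2]
      exacts [Set.insert_subset_insert hH.2.1, Or.inr huH]
    · refine ⟨h.attach_connected hK.1 hK.2.2, ?_, ?_⟩ <;> rw [h.verts_attach hK.2.2]
      exacts [Set.insert_subset_insert hK.2.1, Or.inr huK]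
  · rw [Set.disjoint_left]
    rintro L ⟨-, h1, -⟩ (rfl | rfl)
    · exact h.notMem (h1 (by rw [h.verts_attach hH.2.2]; exact Or.inl rfl))
    · exact h.notMem (h1 (by rw [h.verts_attach hK.2.2]; exact Or.inl rfl))

end IsPendant

end SimpleGraph

/-! ### Connected subgraphs of an induced cycle -/

namespace SimpleGraph

variable {V : Type*} {G : SimpleGraph V}

/-- `p` enumerates cyclically the vertices of an induced cycle of length `g`. -/
structure IsInducedCycle (G : SimpleGraph V) {g : ℕ} (p : ZMod g → V) : Prop where
  injective : Function.Injective p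
  adj_iff : ∀ i j, G.Adj (p i) (p j) ↔ j = i + 1 ∨ i = j + 1

namespace IsInducedCycle

variable {g : ℕ} {p : ZMod g → V}

lemma adj_succ (hp : G.IsInducedCycle p) (i : ZMod g) : G.Adj (p i) (p (i + 1)) :=
  (hp.adj_iff _ _).2 (Or.inl rfl)

/-- The arc `p i, p (i + 1), …, p (i + k)` of the cycle, as a subgraph. -/
def arc (hp : G.IsInducedCycle p) (i : ZMod g) (k : ℕ) : G.Subgraph where
  verts := {x | ∃ j : ℕ, j ≤ k ∧ x = p (i + j)}
  Adj x y := ∃ j : ℕ, j < k ∧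
    ((x = p (i + j) ∧ y = p (i + j + 1)) ∨ (y = p (i + j) ∧ x = p (i + j + 1)))
  adj_sub := by
    rintro x y ⟨j, -, ⟨rfl, rfl⟩ | ⟨rfl, rfl⟩⟩
    exacts [hp.adj_succ _, (hp.adj_succ _).symm]
  edge_vert := by
    rintro x y ⟨j, hj, ⟨rfl, rfl⟩ | ⟨rfl, rfl⟩⟩
    exacts [⟨j, hj.le, rfl⟩, ⟨j + 1, hj, by push_cast; rw [add_assoc]⟩]
  symm := ⟨by
    rintro x y ⟨j, hj, h⟩
    exact ⟨j, hj, h.symm⟩⟩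

/-- The whole cycle, as a subgraph. -/
def full (hp : G.IsInducedCycle p) : G.Subgraph := hp.arc 0 g

lemma arc_connected (hp : G.IsInducedCycle p) (i : ZMod g) (k : ℕ) : (hp.arc i k).Connected := by
  refine Subgraph.connected_of_root (r := p i) ⟨0, Nat.zero_le _, by simp⟩ ?_
  rintro _ ⟨j, hj, rfl⟩
  induction j with
  | zero => simp; rfl
  | succ j ih =>
    refine (ih (by omega)).tail ⟨j, hj, Or.inl ⟨rfl, ?_⟩⟩
    push_cast
    rw [add_assoc]

lemma verts_arc_subset (hp : G.IsInducedCycle p) (i : ZMod g) (k : ℕ) :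
    (hp.arc i k).verts ⊆ Set.range p := by
  rintro _ ⟨j, -, rfl⟩
  exact ⟨_, rfl⟩

lemma eq_of_natCast_eq {j k : ℕ} (hj : j < g) (hk : k < g) (h : (j : ZMod g) = k) : j = k := by
  rw [ZMod.natCast_eq_natCast_iff] at h
  exact h.eq_of_lt_of_lt hj hk

lemma mem_arc_iff [NeZero g] (hp : G.IsInducedCycle p) {i x : ZMod g} {k : ℕ} (hk : k < g) :
    p x ∈ (hp.arc i k).verts ↔ (x - i).val ≤ k := by
  constructor
  · rintro ⟨j, hj, hx⟩
    have := hp.injective hx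
    subst this
    simpa [ZMod.val_natCast_of_lt (hj.trans_lt hk)] using hj
  · intro h
    exact ⟨_, h, by simp⟩

lemma arc_adj_succ_iff [NeZero g] (hg : 3 ≤ g) (hp : G.IsInducedCycle p) {i x : ZMod g} {k : ℕ}
    (hk : k < g) : (hp.arc i k).Adj (p x) (p (x + 1)) ↔ (x - i).val < k := by
  constructor
  · rintro ⟨j, hj, ⟨hx, -⟩ | ⟨hx, hy⟩⟩
    · have := hp.injective hx
      subst this
      simpa [ZMod.val_natCast_of_lt (hj.trans hk)] using hj
    · have h1 := hp.injective hx
      have h2 := hp.injective hy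
      rw [h2] at h1
      -- The same edge traversed backwards would give 2 = 0 modulo `g`, which `3 ≤ g` excludes.
      have h3 : ((2 : ℕ) : ZMod g) = (0 : ℕ) := by
        push_cast
        linear_combination h1
      have := eq_of_natCast_eq (by omega) (by omega) h3
      omega
  · intro h
    exact ⟨_, h, Or.inl (by simp)⟩

lemma mem_full [NeZero g] (hp : G.IsInducedCycle p) (x : ZMod g) : p x ∈ hp.full.verts :=
  ⟨x.val, x.val_lt.le, by simp⟩

lemma full_adj_succ [NeZero g] (hp : G.IsInducedCycle p) (x : ZMod g) :
    hp.full.Adj (p x) (p (x + 1)) :=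
  ⟨x.val, x.val_lt, Or.inl (by simp)⟩

lemma val_neg_one [NeZero g] : (-1 : ZMod g).val + 1 = g := by
  obtain ⟨n, rfl⟩ := Nat.exists_eq_succ_of_ne_zero (NeZero.ne g)
  simp [ZMod.val_neg_one]

/-- The edge entering `p i` has offset g - 1 from `i`, while the edges of the arc have offsets below
`k`. -/
lemma not_arc_adj_pred [NeZero g] (hg : 3 ≤ g) (hp : G.IsInducedCycle p) {i : ZMod g} {k : ℕ}
    (hk : k < g) : ¬ (hp.arc i k).Adj (p (i - 1)) (p i) := by
  have h := hp.arc_adj_succ_iff hg (i := i) (x := i - 1) hk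
  rw [sub_add_cancel] at h
  rw [h]
  have h2 := val_neg_one (g := g)
  have : i - 1 - i = -1 := by ring
  rw [this]
  omega

lemma arc_ne_full [NeZero g] (hg : 3 ≤ g) (hp : G.IsInducedCycle p) {i : ZMod g} {k : ℕ}
    (hk : k < g) : hp.arc i k ≠ hp.full := by
  intro h
  apply hp.not_arc_adj_pred hg (i := i) hk
  rw [h]
  have := hp.full_adj_succ (i - 1)
  rwa [sub_add_cancel] at this

/-- The first vertex of an arc is the only one whose predecessor is not joined to it in the arc. -/
lemma eq_start [NeZero g] (hg : 3 ≤ g) (hp : G.IsInducedCycle p) {i x : ZMod g} {k : ℕ}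
    (hk : k < g) (hx : p x ∈ (hp.arc i k).verts) (hn : ¬ (hp.arc i k).Adj (p (x - 1)) (p x)) :
    x = i := by
  rw [hp.mem_arc_iff hk] at hx
  by_contra hne
  apply hn
  have h := hp.arc_adj_succ_iff hg (i := i) (x := x - 1) hk
  rw [sub_add_cancel] at h
  rw [h]
  have hpos : 0 < (x - i).val := by
    rw [Nat.pos_iff_ne_zero, Ne, ZMod.val_eq_zero, sub_eq_zero]
    exact hne
  have h2 : x - 1 - i = (((x - i).val - 1 : ℕ) : ZMod g) := by
    rw [Nat.cast_sub hpos]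
    simp
    ring
  rw [h2, ZMod.val_natCast_of_lt (by omega)]
  omega

/-- The start is recovered by `eq_start`, and the length is then the largest offset of a vertex in
the arc. -/
lemma arc_inj [NeZero g] (hg : 3 ≤ g) (hp : G.IsInducedCycle p) {i i' : ZMod g} {k k' : ℕ}
    (hk : k < g) (hk' : k' < g) (h : hp.arc i k = hp.arc i' k') : i = i' ∧ k = k' := by
  have hi : i = i' := by
    apply hp.eq_start hg hk'
    · rw [← h, hp.mem_arc_iff hk]; simp
    · rw [← h]; exact hp.not_arc_adj_pred hg hk
  subst hi
  refine ⟨rfl, le_antisymm ?_ ?_⟩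
  · have := (hp.mem_arc_iff (i := i) (x := i + k) hk).2 (by simp [ZMod.val_natCast_of_lt hk])
    rw [h, hp.mem_arc_iff hk'] at this
    simpa [ZMod.val_natCast_of_lt hk] using this
  · have := (hp.mem_arc_iff (i := i) (x := i + k') hk').2 (by simp [ZMod.val_natCast_of_lt hk'])
    rw [← h, hp.mem_arc_iff hk] at this
    simpa [ZMod.val_natCast_of_lt hk'] using this

/-- If every vertex of `H` is joined to its predecessor, `H` goes all the way round. Otherwise start
at a vertex that is not and go forward to the first missing edge: the stretch passed is closed under
adjacency in `H`, hence is all of `H`. -/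
lemma eq_full_or_arc [NeZero g] (hp : G.IsInducedCycle p) {H : G.Subgraph}
    (hH : H.Connected) (hS : H.verts ⊆ Set.range p) :
    H = hp.full ∨ ∃ i, ∃ k < g, H = hp.arc i k := by
  by_cases hall : ∀ x, p x ∈ H.verts → H.Adj (p (x - 1)) (p x)
  · left
    obtain ⟨_, hv⟩ := hH.nonempty
    obtain ⟨x₀, rfl⟩ := hS hv
    have hmem' : ∀ j : ℕ, p (x₀ - j) ∈ H.verts := by
      intro j
      induction j with
      | zero => simpa using hv
      | succ j ih =>
        have := (hall _ ih).fst_mem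
        push_cast
        rwa [sub_sub] at this
    have hmem : ∀ x, p x ∈ H.verts := by
      intro x
      have := hmem' (x₀ - x).val
      simpa using this
    have hadj : ∀ x, H.Adj (p x) (p (x + 1)) := by
      intro x
      have := hall (x + 1) (hmem _)
      rwa [add_sub_cancel_right] at this
    ext x y
    · constructor
      · intro hx
        obtain ⟨a, rfl⟩ := hS hx
        exact hp.mem_full a
      · rintro ⟨j, -, rfl⟩
        exact hmem _
    · constructor
      · intro hxy
        obtain ⟨a, rfl⟩ := hS hxy.fst_mem
        obtain ⟨b, rfl⟩ := hS hxy.snd_mem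
        rcases (hp.adj_iff a b).1 hxy.adj_sub with rfl | rfl
        · exact hp.full_adj_succ a
        · exact (hp.full_adj_succ b).symm
      · rintro ⟨j, -, ⟨rfl, rfl⟩ | ⟨rfl, rfl⟩⟩
        exacts [hadj _, (hadj _).symm]
  · right
    push Not at hall
    obtain ⟨i, hi, hni⟩ := hall
    have hex : ∃ k : ℕ, ¬ H.Adj (p (i + k)) (p (i + k + 1)) := by
      -- At offset g - 1 lies the missing edge into `p i`, so the search stops there at the latest;
      -- this also gives `k < g`.
      refine ⟨(-1 : ZMod g).val, ?_⟩
      simpa [← sub_eq_add_neg] using hni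
    classical
    obtain ⟨k, hk, hmin, hkg⟩ : ∃ k : ℕ, ¬ H.Adj (p (i + k)) (p (i + k + 1)) ∧
        (∀ j < k, H.Adj (p (i + j)) (p (i + j + 1))) ∧ k < g := by
      refine ⟨Nat.find hex, Nat.find_spec hex, fun j hj => not_not.1 (Nat.find_min hex hj), ?_⟩
      refine (Nat.find_min' hex ?_).trans_lt (ZMod.val_lt (-1 : ZMod g))
      simpa [← sub_eq_add_neg] using hni
    have hstep : ∀ j ≤ k, ∀ y, H.Adj (p (i + j)) y → (j < k ∧ y = p (i + j + 1)) ∨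
        ∃ l, j = l + 1 ∧ y = p (i + l) := by
      intro j hj y hy
      obtain ⟨b, rfl⟩ := hS hy.snd_mem
      rcases (hp.adj_iff _ b).1 hy.adj_sub with rfl | hb
      · refine Or.inl ⟨lt_of_le_of_ne hj ?_, rfl⟩
        rintro rfl
        exact hk hy
      · rcases Nat.eq_zero_or_pos j with rfl | hpos
        · exfalso
          apply hni
          have : b = i - 1 := by rw [eq_sub_iff_add_eq, ← hb]; simp
          rw [← this]
          simpa using hy.symm
        · obtain ⟨l, rfl⟩ := Nat.exists_eq_succ_of_ne_zero hpos.ne'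
          refine Or.inr ⟨l, rfl, ?_⟩
          congr 1
          push_cast at hb
          linear_combination -hb
    have hsub : H.verts ⊆ (hp.arc i k).verts := by
      refine hH.verts_subset_of_closed hi ⟨0, Nat.zero_le _, by simp⟩ ?_
      rintro _ ⟨j, hj, rfl⟩ y hy
      rcases hstep j hj y hy with ⟨h1, rfl⟩ | ⟨l, rfl, rfl⟩
      · exact ⟨j + 1, h1, by push_cast; rw [add_assoc]⟩
      · exact ⟨l, by omega, rfl⟩
    refine ⟨i, k, hkg, ?_⟩
    ext x y
    · refine ⟨fun hx => hsub hx, ?_⟩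
      rintro ⟨j, hj, rfl⟩
      rcases Nat.eq_zero_or_pos j with rfl | hpos
      · simpa using hi
      · obtain ⟨l, rfl⟩ := Nat.exists_eq_succ_of_ne_zero hpos.ne'
        have := (hmin l (by omega)).snd_mem
        push_cast
        rwa [add_assoc] at this
    · constructor
      · intro hxy
        obtain ⟨j, hj, rfl⟩ := hsub hxy.fst_mem
        rcases hstep j hj y hxy with ⟨h1, rfl⟩ | ⟨l, rfl, rfl⟩
        · exact ⟨j, h1, Or.inl ⟨rfl, rfl⟩⟩
        · exact ⟨l, hj, Or.inr ⟨rfl, by push_cast; rw [add_assoc]⟩⟩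
      · rintro ⟨j, hj, ⟨rfl, rfl⟩ | ⟨rfl, rfl⟩⟩
        exacts [hmin j hj, (hmin j hj).symm]

lemma connectedIn_range [NeZero g] (hp : G.IsInducedCycle p) :
    G.connectedIn (Set.range p) = insert hp.full
      ((fun x : ZMod g × ℕ => hp.arc x.1 x.2) ''
        ((Finset.univ ×ˢ Finset.range g : Finset (ZMod g × ℕ)) : Set (ZMod g × ℕ))) := by
  ext H
  constructor
  · rintro ⟨hH, hS⟩
    rcases hp.eq_full_or_arc hH hS with rfl | ⟨i, k, hk, rfl⟩
    · exact Or.inl rfl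
    · exact Or.inr ⟨(i, k), by simpa using hk, rfl⟩
  · rintro (rfl | ⟨⟨i, k⟩, -, rfl⟩)
    exacts [⟨hp.arc_connected _ _, hp.verts_arc_subset _ _⟩,
      ⟨hp.arc_connected _ _, hp.verts_arc_subset _ _⟩]

lemma ncard_connectedIn_range [NeZero g] [Finite V] (hg : 3 ≤ g) (hp : G.IsInducedCycle p) :
    (G.connectedIn (Set.range p)).ncard = g * g + 1 := by
  rw [hp.connectedIn_range, Set.ncard_insert_of_notMem _ (Set.toFinite _), Set.InjOn.ncard_image,
    Set.ncard_coe_finset, Finset.card_product, Finset.card_univ, ZMod.card, Finset.card_range]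
  · rintro ⟨i, k⟩ h ⟨i', k'⟩ h' he
    simp only [Finset.coe_product, Set.mem_prod, Finset.mem_coe, Finset.mem_range] at h h'
    obtain ⟨rfl, rfl⟩ := hp.arc_inj hg h.2 h'.2 he
    rfl
  · rintro ⟨⟨i, k⟩, h, he⟩
    simp only [Finset.coe_product, Set.mem_prod, Finset.mem_coe, Finset.mem_range] at h
    exact hp.arc_ne_full hg h.2 he

/-- An arc with `k` edges contains `p t` exactly when it starts d ≤ k places before `t`; this leaves
k + 1 arcs for each k < g. -/
lemma connectedThrough_range [NeZero g] (hp : G.IsInducedCycle p) (t : ZMod g) :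
    G.connectedThrough (Set.range p) (p t) = insert hp.full
      ((fun x : (_ : ℕ) × ℕ => hp.arc (t - x.2) x.1) ''
        ((Finset.range g).sigma fun k => Finset.range (k + 1) : Finset ((_ : ℕ) × ℕ))) := by
  ext H
  constructor
  · rintro ⟨hH, hS, ht⟩
    rcases hp.eq_full_or_arc hH hS with rfl | ⟨i, k, hk, rfl⟩
    · exact Or.inl rfl
    · refine Or.inr ⟨⟨k, (t - i).val⟩, ?_, by simp⟩
      rw [hp.mem_arc_iff hk] at ht
      simp only [Finset.mem_coe, Finset.mem_sigma, Finset.mem_range]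
      omega
  · rintro (rfl | ⟨⟨k, d⟩, h, rfl⟩)
    · exact ⟨hp.arc_connected _ _, hp.verts_arc_subset _ _, hp.mem_full t⟩
    · refine ⟨hp.arc_connected _ _, hp.verts_arc_subset _ _, d, ?_, by simp⟩
      simp only [Finset.mem_coe, Finset.mem_sigma, Finset.mem_range] at h
      exact Nat.lt_succ_iff.1 h.2

lemma ncard_connectedThrough_range [NeZero g] [Finite V] (hg : 3 ≤ g) (hp : G.IsInducedCycle p)
    (t : ZMod g) :
    (G.connectedThrough (Set.range p) (p t)).ncard = ∑ k ∈ Finset.range g, (k + 1) + 1 := by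
  rw [hp.connectedThrough_range, Set.ncard_insert_of_notMem _ (Set.toFinite _),
    Set.InjOn.ncard_image, Set.ncard_coe_finset, Finset.card_sigma]
  · simp
  · rintro ⟨k, d⟩ h ⟨k', d'⟩ h' he
    simp only [Finset.mem_coe, Finset.mem_sigma, Finset.mem_range] at h h'
    obtain ⟨h1, rfl⟩ := hp.arc_inj hg h.1 h'.1 he
    have : d = d' := eq_of_natCast_eq (g := g) (by omega) (by omega) (sub_right_injective h1)
    rw [this]
  · rintro ⟨⟨k, d⟩, h, he⟩
    simp only [Finset.mem_coe, Finset.mem_sigma, Finset.mem_range] at h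
    exact hp.arc_ne_full hg h.1 he

/-- The cycle less an edge, and the cycle. -/
lemma exists_pair_spanning [NeZero g] (hg : 3 ≤ g) (hp : G.IsInducedCycle p) :
    ∃ H K : G.Subgraph, H ≠ K ∧ H.Connected ∧ K.Connected ∧ H.verts = Set.range p ∧
      K.verts = Set.range p := by
  have hlt : g - 1 < g := by omega
  refine ⟨hp.arc 0 (g - 1), hp.full, hp.arc_ne_full hg hlt, hp.arc_connected _ _,
    hp.arc_connected _ _, (hp.verts_arc_subset _ _).antisymm ?_,
    (hp.verts_arc_subset _ _).antisymm ?_⟩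
  · rintro _ ⟨x, rfl⟩
    rw [hp.mem_arc_iff hlt]
    have := ZMod.val_lt (x - 0)
    omega
  · rintro _ ⟨x, rfl⟩
    exact hp.mem_full x

end IsInducedCycle

end SimpleGraph

/-! ### Growth by pendant vertices and comparison with the lollipop -/

namespace SimpleGraph

variable {V : Type*} {G : SimpleGraph V} {g : ℕ} {p : ZMod g → V} {S : Set V}

/-- `G.LeafGrowth p m S`: the set `S` arises from the cycle `p` by adding `m` pendant vertices, one
after the other. -/
inductive LeafGrowth (G : SimpleGraph V) (p : ZMod g → V) : ℕ → Set V → Prop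
  | base : LeafGrowth G p 0 (Set.range p)
  | step {m : ℕ} {S : Set V} {v w : V} :
    LeafGrowth G p m S → G.IsPendant S v w → LeafGrowth G p (m + 1) (insert v S)

/-- Adjacency of the lollipop, on natural numbers. -/
def LollipopAdj (g i j : ℕ) : Prop :=
  (i + 1 = j ∨ (i = 0 ∧ j + 1 = g)) ∨ (j + 1 = i ∨ (j = 0 ∧ i + 1 = g))

lemma lollipop_adj_iff {n : ℕ} (hg : 3 ≤ g) (i j : Fin n) :
    (lollipop n g).Adj i j ↔ LollipopAdj g i j := by
  simp only [lollipop, fromRel_adj, LollipopAdj, ne_eq, Fin.ext_iff]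
  omega

/-- `q 0, …, q (n - 1)` lists the vertices of `S` in such a way that they induce a lollipop. -/
structure IsLollipopOrder (G : SimpleGraph V) (g n : ℕ) (S : Set V) (q : ℕ → V) : Prop where
  injOn : Set.InjOn q (Set.Iio n)
  image_eq : q '' Set.Iio n = S
  adj_iff : ∀ i < n, ∀ j < n, G.Adj (q i) (q j) ↔ LollipopAdj g i j

lemma natCast_eq_add_one_iff {i j : ℕ} (hi : i < g) (hj : j < g) :
    (j : ZMod g) = i + 1 ↔ j = i + 1 ∨ (i + 1 = g ∧ j = 0) := by
  constructor
  · intro h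
    by_cases hi' : i + 1 = g
    · refine Or.inr ⟨hi', IsInducedCycle.eq_of_natCast_eq (g := g) hj (by omega) ?_⟩
      rw [h]
      have : ((i + 1 : ℕ) : ZMod g) = 0 := by rw [hi']; simp
      push_cast at this ⊢
      exact this
    · refine Or.inl (IsInducedCycle.eq_of_natCast_eq (g := g) hj (by omega) ?_)
      rw [h]; push_cast; rfl
  · rintro (rfl | ⟨h, rfl⟩)
    · push_cast; rfl
    · have : ((i + 1 : ℕ) : ZMod g) = 0 := by rw [h]; simp
      push_cast at this ⊢
      exact this.symm

/-- The numbering starts just after `t` so that `p t` comes last, where a tail can be attached. -/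
lemma IsInducedCycle.isLollipopOrder [NeZero g] (hp : G.IsInducedCycle p)
    (t : ZMod g) : G.IsLollipopOrder g g (Set.range p) fun i => p (t + 1 + i) where
  injOn := by
    intro i hi j hj h
    exact eq_of_natCast_eq hi hj (add_right_injective _ (hp.injective h))
  image_eq := by
    ext x
    constructor
    · rintro ⟨i, -, rfl⟩
      exact ⟨_, rfl⟩
    · rintro ⟨y, rfl⟩
      exact ⟨(y - (t + 1)).val, ZMod.val_lt _, by simp⟩
  adj_iff := by
    intro i hi j hj
    rw [hp.adj_iff, add_assoc (t + 1), add_assoc (t + 1), add_right_inj, add_right_inj,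
      natCast_eq_add_one_iff hi hj, natCast_eq_add_one_iff hj hi, LollipopAdj]
    omega

lemma IsLollipopOrder.extend {n : ℕ} {q : ℕ → V} (hq : G.IsLollipopOrder g n S q) (hgn : g ≤ n)
    {v : V} (h : G.IsPendant S v (q (n - 1))) (_hg : 2 ≤ g) :
    G.IsLollipopOrder g (n + 1) (insert v S) (Function.update q n v) := by
  have hmem : ∀ i < n, q i ∈ S := fun i hi => hq.image_eq ▸ ⟨i, hi, rfl⟩
  have hlast : ∀ i < n, G.Adj v (q i) ↔ i + 1 = n := by
    intro i hi
    rw [h.adj_iff _ (hmem i hi)]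
    constructor
    · intro he
      have := hq.injOn hi (show n - 1 < n by omega) he
      omega
    · rintro rfl
      rfl
  have hupd : ∀ i < n, Function.update q n v i = q i := fun i hi =>
    Function.update_of_ne hi.ne _ _
  refine ⟨?_, ?_, ?_⟩
  · intro i hi j hj hij
    simp only [Set.mem_Iio] at hi hj
    rcases Nat.lt_succ_iff_lt_or_eq.1 hi with hi | rfl <;>
      rcases Nat.lt_succ_iff_lt_or_eq.1 hj with hj | rfl
    · rw [hupd _ hi, hupd _ hj] at hij
      exact hq.injOn hi hj hij
    · rw [hupd _ hi, Function.update_self] at hij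
      exact (h.notMem (hij ▸ hmem _ hi)).elim
    · rw [hupd _ hj, Function.update_self] at hij
      exact (h.notMem (hij ▸ hmem _ hj)).elim
    · rfl
  · have hIio : Set.Iio (n + 1) = insert n (Set.Iio n) := by
      ext i
      simp only [Set.mem_Iio, Set.mem_insert_iff]
      omega
    rw [hIio, Set.image_insert_eq, Function.update_self, ← hq.image_eq]
    congr 1
    exact Set.image_congr fun i hi => hupd i hi
  · intro i hi j hj
    rcases Nat.lt_succ_iff_lt_or_eq.1 hi with hi | rfl <;>
      rcases Nat.lt_succ_iff_lt_or_eq.1 hj with hj | rfl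
    · rw [hupd _ hi, hupd _ hj]
      exact hq.adj_iff i hi j hj
    · rw [hupd _ hi, Function.update_self, adj_comm, hlast i hi, LollipopAdj]
      omega
    · rw [hupd _ hj, Function.update_self, hlast j hj, LollipopAdj]
      omega
    · simp only [SimpleGraph.irrefl, LollipopAdj, false_iff]
      omega

/-- An ordering of all vertices gives an isomorphism with the lollipop. -/
lemma IsLollipopOrder.nonempty_iso {n : ℕ} {q : ℕ → V} (hg : 3 ≤ g)
    (hq : G.IsLollipopOrder g n Set.univ q) : Nonempty (G ≃g lollipop n g) := by
  have hb : Function.Bijective fun i : Fin n => q i := by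
    constructor
    · intro i j h
      exact Fin.ext (hq.injOn i.2 j.2 h)
    · intro x
      obtain ⟨i, hi, rfl⟩ : x ∈ q '' Set.Iio n := hq.image_eq ▸ Set.mem_univ x
      exact ⟨⟨i, hi⟩, rfl⟩
  refine ⟨(⟨Equiv.ofBijective _ hb, ?_⟩ : lollipop n g ≃g G).symm⟩
  intro i j
  rw [lollipop_adj_iff hg]
  exact hq.adj_iff i i.2 j j.2

/-- The number of connected subgraphs through the end vertex of a lollipop with `m` vertices off its
cycle. -/
def lollipopEndCount (g m : ℕ) : ℕ := m + (∑ k ∈ Finset.range g, (k + 1) + 1)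

/-- The number of connected subgraphs of a lollipop with `m` vertices off its cycle. -/
def lollipopCount (g m : ℕ) : ℕ := g * g + 1 + ∑ j ∈ Finset.range m, (lollipopEndCount g j + 1)

namespace LeafGrowth

variable {m : ℕ}

/-- The two spanning subgraphs of the cycle stay distinct when every new pendant edge is attached to
both. -/
lemma exists_pair_spanning [NeZero g] (hg : 3 ≤ g) (hp : G.IsInducedCycle p)
    (h : G.LeafGrowth p m S) :
    ∃ H K : G.Subgraph, H ≠ K ∧ H.Connected ∧ K.Connected ∧ H.verts = S ∧ K.verts = S := by
  induction h with
  | base => exact hp.exists_pair_spanning hg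
  | @step m S v w _ hvw ih =>
    obtain ⟨H, K, hHK, hH, hK, hHS, hKS⟩ := ih
    have hwH : w ∈ H.verts := hHS ▸ hvw.mem
    have hwK : w ∈ K.verts := hKS ▸ hvw.mem
    refine ⟨hvw.attach H, hvw.attach K, fun he => hHK ?_, hvw.attach_connected hH hwH,
      hvw.attach_connected hK hwK, by rw [hvw.verts_attach hwH, hHS],
      by rw [hvw.verts_attach hwK, hKS]⟩
    exact hvw.attach_injOn ⟨hH, hHS.le, hwH⟩ ⟨hK, hKS.le, hwK⟩ he

lemma ncard_eq [Finite V] [NeZero g] (hp : G.IsInducedCycle p) (h : G.LeafGrowth p m S) :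
    S.ncard = g + m := by
  induction h with
  | base =>
    rw [← Set.image_univ, Set.ncard_image_of_injective _ hp.injective, Set.ncard_univ,
      Nat.card_zmod, add_zero]
  | step _ hvw ih => rw [Set.ncard_insert_of_notMem hvw.notMem (Set.toFinite _), ih]; rfl

/-- Induction for all `u` at once. If `u` is the new leaf, both its count and the bound are one more
than for its neighbour, so the equality case carries over and the lollipop grows at its end. If `u`
is older, its count rises by at least two and the bound by one, so equality cannot occur. -/
lemma lollipopEndCount_le [Finite V] [NeZero g] (hg : 3 ≤ g) (hp : G.IsInducedCycle p)
    (h : G.LeafGrowth p m S) : ∀ u ∈ S, lollipopEndCount g m ≤ (G.connectedThrough S u).ncard ∧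
      ((G.connectedThrough S u).ncard = lollipopEndCount g m →
        ∃ q, G.IsLollipopOrder g (g + m) S q ∧ q (g + m - 1) = u) := by
  induction h with
  | base =>
    rintro _ ⟨t, rfl⟩
    refine ⟨by rw [hp.ncard_connectedThrough_range hg, lollipopEndCount, zero_add], fun _ =>
      ⟨_, hp.isLollipopOrder t, ?_⟩⟩
    simp only [add_zero]
    rw [Nat.cast_sub (by omega)]
    simp
  | @step m S v w hS hvw ih =>
    intro u hu
    rcases hu with rfl | hu
    · obtain ⟨h1, h2⟩ := ih w hvw.mem
      rw [hvw.ncard_connectedThrough_insert_self]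
      unfold lollipopEndCount at *
      refine ⟨by omega, fun he => ?_⟩
      obtain ⟨q, hq, rfl⟩ := h2 (by omega)
      exact ⟨_, hq.extend (by omega) hvw (by omega), by simp [← add_assoc]⟩
    · obtain ⟨H, K, hHK, hH, hK, hHS, hKS⟩ := hS.exists_pair_spanning hg hp
      have h1 := hvw.ncard_connectedThrough_add_two_le hHK (u := u)
        ⟨hH, hHS.le, hHS ▸ hvw.mem⟩ ⟨hK, hKS.le, hKS ▸ hvw.mem⟩ (hHS ▸ hu) (hKS ▸ hu)
      have h2 := (ih u hu).1
      unfold lollipopEndCount at *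
      exact ⟨by omega, fun he => by omega⟩

/-- Equality in the total forces equality in the count through the last neighbour `w`; that alone
makes the earlier set a lollipop ending at `w`. -/
lemma lollipopCount_le [Finite V] [NeZero g] (hg : 3 ≤ g) (hp : G.IsInducedCycle p)
    (h : G.LeafGrowth p m S) : lollipopCount g m ≤ (G.connectedIn S).ncard ∧
      ((G.connectedIn S).ncard = lollipopCount g m → ∃ q, G.IsLollipopOrder g (g + m) S q) := by
  induction h with
  | base =>
    exact ⟨by simp [hp.ncard_connectedIn_range hg, lollipopCount], fun _ =>
      ⟨_, hp.isLollipopOrder 0⟩⟩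
  | @step m S v w hS hvw ih =>
    obtain ⟨h1, h2⟩ := hS.lollipopEndCount_le hg hp w hvw.mem
    rw [hvw.ncard_connectedIn_insert, lollipopCount, Finset.sum_range_succ, ← add_assoc,
      ← lollipopCount]
    refine ⟨by omega, fun he => ?_⟩
    obtain ⟨q, hq, rfl⟩ := h2 (by omega)
    exact ⟨_, hq.extend (by omega) hvw (by omega)⟩

end LeafGrowth

end SimpleGraph

/-! ### Unicyclic graphs arise from their cycle by pendant vertices -/

namespace SimpleGraph

variable {V : Type*} {G : SimpleGraph V} {g : ℕ} {p : ZMod g → V} {S : Set V}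

/-- The edges of `G` with both ends in `S`. -/
def edgesIn (G : SimpleGraph V) (S : Set V) : Set (Sym2 V) := {e | e ∈ G.edgeSet ∧ ∀ x ∈ e, x ∈ S}

lemma mk_mem_edgesIn {x y : V} : s(x, y) ∈ G.edgesIn S ↔ G.Adj x y ∧ x ∈ S ∧ y ∈ S := by
  simp [edgesIn]

lemma ncard_edgesIn_add_le [Finite V] {v : V} (hv : v ∉ S) {T : Set V} (hT : T ⊆ S)
    (hadj : ∀ x ∈ T, G.Adj v x) :
    (G.edgesIn S).ncard + T.ncard ≤ (G.edgesIn (insert v S)).ncard := by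
  have hinj : Set.InjOn (fun x => s(v, x)) T := by
    intro x _ y _ h
    exact Sym2.congr_right.1 h
  rw [← hinj.ncard_image, ← Set.ncard_union_eq _ (Set.toFinite _) (Set.toFinite _)]
  · refine Set.ncard_le_ncard ?_ (Set.toFinite _)
    rintro e (⟨h1, h2⟩ | ⟨x, hx, rfl⟩)
    · exact ⟨h1, fun x hx => Or.inr (h2 x hx)⟩
    · exact mk_mem_edgesIn.2 ⟨hadj x hx, Or.inl rfl, Or.inr (hT hx)⟩
  · rw [Set.disjoint_left]
    rintro _ ⟨_, h⟩ ⟨x, hx, rfl⟩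
    exact hv (h v (by simp))

lemma Connected.exists_adj_boundary (hG : G.Connected) (hS : S.Nonempty) (hne : Sᶜ.Nonempty) :
    ∃ v w, v ∉ S ∧ w ∈ S ∧ G.Adj v w := by
  obtain ⟨a, ha⟩ := hS
  obtain ⟨b, hb⟩ := hne
  obtain ⟨W⟩ := hG.preconnected a b
  obtain ⟨d, -, h1, h2⟩ := W.exists_boundary_dart S ha hb
  exact ⟨d.snd, d.fst, h2, h1, d.adj.symm⟩

lemma ncard_compl_insert [Finite V] {v : V} (hv : v ∉ S) :
    (insert v S)ᶜ.ncard + 1 = Sᶜ.ncard := by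
  have h1 := Set.ncard_add_ncard_compl S
  have h2 := Set.ncard_add_ncard_compl (insert v S)
  have h3 := Set.ncard_insert_of_notMem hv (Set.toFinite _)
  omega

/-- In a connected graph every vertex outside a nonempty `S` costs at least one edge. -/
lemma Connected.ncard_edgesIn_add_ncard_compl_le [Finite V] (hG : G.Connected)
    (hS : S.Nonempty) : (G.edgesIn S).ncard + Sᶜ.ncard ≤ G.edgeSet.ncard := by
  induction hk : Sᶜ.ncard generalizing S with
  | zero => exact Set.ncard_le_ncard (fun e he => he.1) (Set.toFinite _)
  | succ k ih =>
    obtain ⟨v, w, hv, hw, hvw⟩ := hG.exists_adj_boundary hS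
      ((Set.ncard_pos (Set.toFinite _)).1 (by omega))
    have h1 := ncard_compl_insert hv
    have h2 := ih (Set.insert_nonempty v S) (by omega)
    have h3 := ncard_edgesIn_add_le (G := G) hv (T := {w}) (by simpa) (by simpa)
    rw [Set.ncard_singleton] at h3
    omega

/-- In a connected graph with as many edges as vertices, a set with as many inner edges as vertices
grows to the whole vertex set by adding pendant vertices. -/
lemma LeafGrowth.exists_univ [Finite V] [NeZero g] (hp : G.IsInducedCycle p) (hG : G.Connected)
    (hcard : G.edgeSet.ncard = Nat.card V) {m : ℕ} (h : G.LeafGrowth p m S)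
    (hS : (G.edgesIn S).ncard = S.ncard) : ∃ m', G.LeafGrowth p m' Set.univ := by
  induction hk : Sᶜ.ncard generalizing S m with
  | zero =>
    rw [Set.ncard_eq_zero (Set.toFinite _), Set.compl_empty_iff] at hk
    exact ⟨m, hk ▸ h⟩
  | succ k ih =>
    have hne : S.Nonempty := by
      rw [← Set.ncard_pos (Set.toFinite _), h.ncard_eq hp]
      have := NeZero.pos g
      omega
    obtain ⟨v, w, hv, hw, hvw⟩ := hG.exists_adj_boundary hne
      ((Set.ncard_pos (Set.toFinite _)).1 (by omega))
    have h1 := ncard_compl_insert hv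
    have h2 := hG.ncard_edgesIn_add_ncard_compl_le (Set.insert_nonempty v S)
    have h3 := Set.ncard_add_ncard_compl S
    have h4 := ncard_edgesIn_add_le (G := G) hv (T := {w}) (by simpa) (by simpa)
    rw [Set.ncard_singleton] at h4
    refine ih (h.step (v := v) (w := w) ⟨hv, hw, fun x hx => ⟨fun hvx => ?_, ?_⟩⟩) ?_ (by omega)
    · by_contra hxw
      -- A second neighbour would give |S| + 2 edges inside `insert v S`; with one edge for each
      -- vertex outside, the graph would have more edges than vertices.
      have h5 := ncard_edgesIn_add_le (G := G) hv (T := {x, w}) (Set.pair_subset hx hw)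
        (by simp [hvx, hvw])
      rw [Set.ncard_pair hxw] at h5
      omega
    · rintro rfl
      exact hvw
    · rw [Set.ncard_insert_of_notMem hv (Set.toFinite _)]
      omega

lemma Walk.IsCycle.exists_cyclic_order {a : V} {c : G.Walk a a} (hc : c.IsCycle) :
    ∃ p : ZMod c.length → V, Function.Injective p ∧ ∀ i, G.Adj (p i) (p (i + 1)) := by
  have h3 := hc.three_le_length
  have : NeZero c.length := ⟨by omega⟩
  refine ⟨fun i => c.getVert i.val, fun i j h => ?_, fun i => ?_⟩
  · have hi := ZMod.val_lt i
    have hj := ZMod.val_lt j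
    exact ZMod.val_injective _ (hc.getVert_injOn' (by simp; omega) (by simp; omega) h)
  · have hi := ZMod.val_lt i
    have hadj := c.adj_getVert_succ hi
    have hcast := natCast_eq_add_one_iff hi (ZMod.val_lt (i + 1))
    simp only [ZMod.natCast_val, ZMod.cast_id', id, true_iff] at hcast
    rcases hcast with h | ⟨h1, h2⟩
    · simpa only [h] using hadj
    · simp only [h2, Walk.getVert_zero]
      rwa [h1, Walk.getVert_length] at hadj

lemma injective_mk_succ (hg : 3 ≤ g) (hinj : Function.Injective p) :
    Function.Injective fun i : ZMod g => s(p i, p (i + 1)) := by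
  intro i j h
  rcases Sym2.eq_iff.1 h with ⟨h1, -⟩ | ⟨h1, h2⟩
  · exact hinj h1
  · have h1 := hinj h1
    have h2 := hinj h2
    have h3 : ((2 : ℕ) : ZMod g) = (0 : ℕ) := by
      push_cast
      linear_combination h2 - h1
    have := IsInducedCycle.eq_of_natCast_eq (by omega) (by omega) h3
    omega

/-- A connected graph with as many edges as vertices has no further edges between the vertices of a
cycle. -/
lemma Connected.isInducedCycle_of_card_eq [Finite V] [NeZero g] (hg : 3 ≤ g) (hG : G.Connected)
    (hcard : G.edgeSet.ncard = Nat.card V) (hinj : Function.Injective p)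
    (hadj : ∀ i, G.Adj (p i) (p (i + 1))) :
    G.IsInducedCycle p ∧ (G.edgesIn (Set.range p)).ncard = (Set.range p).ncard := by
  have hrange : (Set.range p).ncard = g := by
    rw [← Set.image_univ, Set.ncard_image_of_injective _ hinj, Set.ncard_univ, Nat.card_zmod]
  have himg : (Set.range fun i : ZMod g => s(p i, p (i + 1))).ncard = g := by
    rw [← Set.image_univ, Set.ncard_image_of_injective _ (injective_mk_succ hg hinj),
      Set.ncard_univ, Nat.card_zmod]
  have hsub : (Set.range fun i : ZMod g => s(p i, p (i + 1))) ⊆ G.edgesIn (Set.range p) := by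
    rintro _ ⟨i, rfl⟩
    exact mk_mem_edgesIn.2 ⟨hadj i, ⟨_, rfl⟩, ⟨_, rfl⟩⟩
  have h1 := hG.ncard_edgesIn_add_ncard_compl_le (Set.range_nonempty p)
  have h2 := Set.ncard_add_ncard_compl (Set.range p)
  -- Each vertex off the cycle uses up an edge, so at most `g` edges remain between cycle vertices,
  -- and the cycle has that many.
  have heq := Set.eq_of_subset_of_ncard_le hsub (by omega) (Set.toFinite _)
  refine ⟨⟨hinj, fun i j => ⟨fun hij => ?_, ?_⟩⟩, by rw [← heq, himg, hrange]⟩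
  · have hmem : s(p i, p j) ∈ G.edgesIn (Set.range p) :=
      mk_mem_edgesIn.2 ⟨hij, ⟨_, rfl⟩, ⟨_, rfl⟩⟩
    rw [← heq] at hmem
    obtain ⟨k, hk⟩ := hmem
    rcases Sym2.eq_iff.1 hk with ⟨h1, h2⟩ | ⟨h1, h2⟩
    · rw [← hinj h1, ← hinj h2]; exact Or.inl rfl
    · rw [← hinj h1, ← hinj h2]; exact Or.inr rfl
  · rintro (rfl | rfl)
    exacts [hadj i, (hadj j).symm]

lemma IsUnicyclicWithGirth.exists_leafGrowth [Finite V] {n : ℕ} (hg : 3 ≤ g)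
    (hG : G.IsUnicyclicWithGirth n g) : ∃ p : ZMod g → V, G.IsInducedCycle p ∧
      ∃ m, g + m = n ∧ G.LeafGrowth p m Set.univ := by
  have : NeZero g := ⟨by omega⟩
  -- Acyclic graphs have girth 0 by convention.
  have hac : ¬ G.IsAcyclic := fun h => by
    have := girth_eq_zero.2 h
    have := hG.girth_eq
    omega
  obtain ⟨a, c, hc, hlen⟩ := exists_girth_eq_length.2 hac
  rw [hG.girth_eq] at hlen
  obtain ⟨p, hinj, hadj⟩ : ∃ p : ZMod g → V, Function.Injective p ∧
      ∀ i, G.Adj (p i) (p (i + 1)) := hlen ▸ hc.exists_cyclic_order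
  have hcard : G.edgeSet.ncard = Nat.card V := hG.card_edges.trans hG.card_verts.symm
  obtain ⟨hp, he⟩ := hG.connected.isInducedCycle_of_card_eq hg hcard hinj hadj
  obtain ⟨m, hm⟩ := LeafGrowth.base.exists_univ hp hG.connected hcard he
  refine ⟨p, hp, m, ?_, hm⟩
  rw [← hm.ncard_eq hp, Set.ncard_univ, hG.card_verts]

end SimpleGraph

/-! ### The lollipop: unicyclicity, girth and exact count -/

namespace SimpleGraph

variable {g n : ℕ}

lemma lollipop_connected (hg : 3 ≤ g) (hgn : g < n) : (lollipop n g).Connected := by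
  have h0 : 0 < n := by omega
  rw [connected_iff_exists_forall_reachable]
  refine ⟨⟨0, h0⟩, ?_⟩
  rintro ⟨i, hi⟩
  induction i with
  | zero => rfl
  | succ i ih =>
    refine (ih (by omega)).trans (Adj.reachable ?_)
    rw [lollipop_adj_iff hg]
    exact Or.inl (Or.inl rfl)

lemma ncard_edgeSet_lollipop (hg : 3 ≤ g) (hgn : g < n) :
    (lollipop n g).edgeSet.ncard = n := by
  have h0 : 0 < n := by omega
  -- Edge `k` joins `k` to k + 1; the index n - 1, which has no successor, is given to the edge
  -- closing the cycle.
  let f : Fin n → Sym2 (Fin n) := fun k =>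
    if h : k.val + 1 < n then s(k, ⟨k.val + 1, h⟩) else s(⟨0, h0⟩, ⟨g - 1, by omega⟩)
  have hf : Function.Injective f := by
    intro i j hij
    have := i.2
    have := j.2
    apply Fin.ext
    simp only [f] at hij
    split_ifs at hij with h1 h2 h2
    · simp only [Sym2.eq_iff, Fin.ext_iff] at hij
      omega
    · simp only [Sym2.eq_iff, Fin.ext_iff] at hij
      omega
    · simp only [Sym2.eq_iff, Fin.ext_iff] at hij
      omega
    · omega
  have hrange : (lollipop n g).edgeSet = Set.range f := by
    have key : ∀ i j : Fin n, (i.val + 1 = j.val ∨ (i.val = 0 ∧ j.val + 1 = g)) →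
        s(i, j) ∈ Set.range f := by
      rintro ⟨i, hi⟩ ⟨j, hj⟩ (h | ⟨h1, h2⟩)
      · simp only at h
        subst h
        exact ⟨⟨i, hi⟩, by simp [f, hj]⟩
      · simp only at h1 h2
        subst h1 h2
        refine ⟨⟨n - 1, by omega⟩, ?_⟩
        simp only [f]
        rw [dif_neg (by omega)]
        rfl
    ext e
    induction e using Sym2.ind with
    | _ i j =>
      rw [mem_edgeSet, lollipop_adj_iff hg]
      constructor
      · rintro (h | h)
        · exact key i j h
        · rw [Sym2.eq_swap]
          exact key j i h
      · rintro ⟨k, hk⟩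
        simp only [f] at hk
        unfold LollipopAdj
        split_ifs at hk
        · simp only [Sym2.eq_iff, Fin.ext_iff] at hk
          omega
        · simp only [Sym2.eq_iff, Fin.ext_iff] at hk
          omega
  rw [hrange, ← Set.image_univ, Set.ncard_image_of_injective _ hf, Set.ncard_univ, Nat.card_fin]

/-- The cycle of the lollipop. -/
def lollipopCycle [NeZero g] (hgn : g < n) (i : ZMod g) : Fin n := ⟨i.val, i.val_lt.trans hgn⟩

lemma mem_range_lollipopCycle [NeZero g] (hgn : g < n) (i : Fin n) :
    i ∈ Set.range (lollipopCycle hgn) ↔ i.val < g := by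
  constructor
  · rintro ⟨j, rfl⟩
    exact j.val_lt
  · intro h
    exact ⟨(i.val : ZMod g), Fin.ext (ZMod.val_natCast_of_lt h)⟩

lemma isInducedCycle_lollipopCycle [NeZero g] (hg : 3 ≤ g) (hgn : g < n) :
    (lollipop n g).IsInducedCycle (lollipopCycle hgn) where
  injective i j h := ZMod.val_injective g (Fin.ext_iff.1 h)
  adj_iff i j := by
    rw [lollipop_adj_iff hg, LollipopAdj]
    simp only [lollipopCycle]
    have h1 := natCast_eq_add_one_iff (ZMod.val_lt i) (ZMod.val_lt j)
    have h2 := natCast_eq_add_one_iff (ZMod.val_lt j) (ZMod.val_lt i)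
    simp only [ZMod.natCast_val, ZMod.cast_id', id] at h1 h2
    rw [h1, h2]
    omega

/-- Each vertex of `c` has two neighbours along `c`. The largest label on `c` is below `g`, since
otherwise only its predecessor could be a neighbour. If `c` visits a vertex of the g-cycle but not
its successor, again only one neighbour is left. So `c` visits exactly the vertices of the g-cycle.
-/
lemma Walk.IsCycle.length_lollipop (hg : 3 ≤ g) (hgn : g < n) {a : Fin n}
    {c : (lollipop n g).Walk a a} (hc : c.IsCycle) : c.length = g := by
  have : NeZero g := ⟨by omega⟩
  have hp := isInducedCycle_lollipopCycle hg hgn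
  have hdeg : ∀ x ∈ c.support, ¬ ∃ z, c.toSubgraph.neighborSet x ⊆ {z} := by
    rintro x hx ⟨z, hz⟩
    have h1 := hc.ncard_neighborSet_toSubgraph_eq_two hx
    have h2 := Set.ncard_le_ncard hz (Set.toFinite _)
    rw [Set.ncard_singleton] at h2
    omega
  have hlt : ∀ x ∈ c.support, x.val < g := by
    obtain ⟨x, hx, hmax⟩ := c.support.toFinset.exists_max_image Fin.val ⟨a, by simp⟩
    rw [List.mem_toFinset] at hx
    intro y hy
    refine (hmax y (by simpa using hy)).trans_lt ?_
    by_contra hxg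
    refine hdeg x hx ⟨⟨x.val - 1, by omega⟩, fun y hy => ?_⟩
    have hadj := (lollipop_adj_iff hg x y).1 hy.adj_sub
    have hle := hmax y (by simpa using c.mem_verts_toSubgraph.1 hy.snd_mem)
    rw [Set.mem_singleton_iff, Fin.ext_iff]
    unfold LollipopAdj at hadj
    simp only
    omega
  have hsucc : ∀ i, lollipopCycle hgn i ∈ c.support → lollipopCycle hgn (i + 1) ∈ c.support := by
    intro i hi
    by_contra hcon
    refine hdeg _ hi ⟨lollipopCycle hgn (i - 1), fun y hy => ?_⟩
    have hys := c.mem_verts_toSubgraph.1 hy.snd_mem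
    obtain ⟨j, rfl⟩ := (mem_range_lollipopCycle hgn y).2 (hlt y hys)
    rcases (hp.adj_iff i j).1 hy.adj_sub with rfl | rfl
    · exact (hcon hys).elim
    · simp
  obtain ⟨i₀, hi₀⟩ := (mem_range_lollipopCycle hgn a).2 (hlt a c.start_mem_support)
  have hall : ∀ i, lollipopCycle hgn i ∈ c.support := by
    have hnat : ∀ k : ℕ, lollipopCycle hgn (i₀ + k) ∈ c.support := by
      intro k
      induction k with
      | zero => simp [hi₀]
      | succ k ih =>
        have := hsucc _ ih
        push_cast
        rwa [← add_assoc]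
    intro i
    have := hnat (i - i₀).val
    simpa using this
  -- The support lists the base point twice; its tail lists every vertex once and has length
  -- `c.length`.
  have htail : ∀ x, x ∈ c.support.tail ↔ x ∈ c.support := by
    intro x
    refine ⟨List.mem_of_mem_tail, fun hx => ?_⟩
    rcases (Walk.mem_support_iff c).1 hx with rfl | hx
    · exact Walk.end_mem_tail_support hc.not_nil
    · exact hx
  have hset : ((c.support.tail.toFinset : Finset (Fin n)) : Set (Fin n)) =
      Set.range (lollipopCycle hgn) := by
    ext x
    rw [Finset.mem_coe, List.mem_toFinset, htail]
    refine ⟨fun hx => (mem_range_lollipopCycle hgn x).2 (hlt x hx), ?_⟩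
    rintro ⟨i, rfl⟩
    exact hall i
  have hcard := congrArg Set.ncard hset
  rw [Set.ncard_coe_finset, List.toFinset_card_of_nodup hc.support_nodup, ← Set.image_univ,
    Set.ncard_image_of_injective _ hp.injective, Set.ncard_univ, Nat.card_zmod] at hcard
  simpa using hcard

lemma girth_lollipop (hg : 3 ≤ g) (hgn : g < n) : (lollipop n g).girth = g := by
  have hac : ¬ (lollipop n g).IsAcyclic := by
    intro h
    classical
    have htree : (lollipop n g).IsTree := ⟨lollipop_connected hg hgn, h⟩
    have h1 := htree.card_edgeFinset
    have h2 := ncard_edgeSet_lollipop hg hgn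
    rw [← coe_edgeFinset, Set.ncard_coe_finset] at h2
    rw [Fintype.card_fin] at h1
    omega
  obtain ⟨a, c, hc, hlen⟩ := exists_girth_eq_length.2 hac
  rw [hlen, hc.length_lollipop hg hgn]

lemma isUnicyclicWithGirth_lollipop (hg : 3 ≤ g) (hgn : g < n) :
    (lollipop n g).IsUnicyclicWithGirth n g :=
  ⟨lollipop_connected hg hgn, by simp, ncard_edgeSet_lollipop hg hgn, girth_lollipop hg hgn⟩

/-- From label `g` on, the closing edge is out of reach, so the only smaller neighbour is the
predecessor. -/
lemma isPendant_lollipop (hg : 3 ≤ g) {k : ℕ} (hgk : g ≤ k) (hkn : k < n) :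
    (lollipop n g).IsPendant {i | i.val < k} ⟨k, hkn⟩ ⟨k - 1, by omega⟩ where
  notMem := by simp
  mem := by simp; omega
  adj_iff x hx := by
    simp only [Set.mem_ofPred_eq] at hx
    rw [lollipop_adj_iff hg, LollipopAdj, Fin.ext_iff]
    simp only
    omega

/-- The pendant recursions are equalities along the tail. Both counts go through one induction
because each new total needs the previous end count. -/
lemma ncard_lollipop_initial (hg : 3 ≤ g) (hgn : g < n) {m : ℕ} (hm : g + m ≤ n) :
    ((lollipop n g).connectedIn {i | i.val < g + m}).ncard = lollipopCount g m ∧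
      ((lollipop n g).connectedThrough {i | i.val < g + m} ⟨g + m - 1, by omega⟩).ncard =
        lollipopEndCount g m := by
  have : NeZero g := ⟨by omega⟩
  have hp := isInducedCycle_lollipopCycle hg hgn
  induction m with
  | zero =>
    have hS : {i : Fin n | i.val < g + 0} = Set.range (lollipopCycle hgn) := by
      ext i
      rw [mem_range_lollipopCycle]
      rfl
    have hmem : (⟨g + 0 - 1, by omega⟩ : Fin n) ∈ Set.range (lollipopCycle hgn) := by
      rw [mem_range_lollipopCycle]
      simp only
      omega
    obtain ⟨t, ht⟩ := hmem
    rw [hS, ← ht, hp.ncard_connectedIn_range hg, hp.ncard_connectedThrough_range hg]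
    simp [lollipopCount, lollipopEndCount]
  | succ m ih =>
    obtain ⟨h1, h2⟩ := ih (by omega)
    have hpend := isPendant_lollipop hg (k := g + m) (by omega) (show g + m < n by omega)
    have hS : {i : Fin n | i.val < g + (m + 1)} =
        insert ⟨g + m, by omega⟩ {i : Fin n | i.val < g + m} := by
      ext i
      simp only [Set.mem_ofPred_eq, Set.mem_insert_iff, Fin.ext_iff]
      omega
    rw [hS]
    constructor
    · rw [hpend.ncard_connectedIn_insert, h1, h2, lollipopCount, lollipopCount,
        Finset.sum_range_succ, add_assoc]
    · have := hpend.ncard_connectedThrough_insert_self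
      rw [h2] at this
      refine this.trans ?_
      unfold lollipopEndCount
      omega

lemma coreIndex_lollipop (hg : 3 ≤ g) (hgn : g < n) {m : ℕ} (hm : g + m = n) :
    (lollipop n g).coreIndex = lollipopCount g m := by
  rw [coreIndex_eq_ncard_connectedIn_univ, ← (ncard_lollipop_initial hg hgn hm.le).1]
  congr 2
  ext i
  simp [hm]

/-- The tail vertex with index `j` contributes j + g(g+1)/2 + 2, to be summed over j < m. -/
lemma lollipopCount_cast (g m : ℕ) : (lollipopCount g m : ℚ) =
    (m : ℚ) / 2 * ((g + m : ℚ) + (g : ℚ) ^ 2 + 3) + (g : ℚ) ^ 2 + 1 := by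
  have hsum : ((∑ k ∈ Finset.range g, (k + 1) : ℕ) : ℚ) = (g : ℚ) * (g + 1) / 2 := by
    induction g with
    | zero => simp
    | succ g ih =>
      rw [Finset.sum_range_succ, Nat.cast_add, ih]
      push_cast
      ring
  induction m with
  | zero => simp [lollipopCount]; ring
  | succ m ih =>
    rw [lollipopCount, Finset.sum_range_succ, ← add_assoc, ← lollipopCount, Nat.cast_add, ih,
      lollipopEndCount, Nat.cast_add, Nat.cast_add, Nat.cast_add, hsum]
    push_cast
    ring

/-! ### Isomorphism invariance and the theorem -/

lemma Subgraph.Connected.map_hom {V W : Type*} {G : SimpleGraph V} {G' : SimpleGraph W}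
    (f : G →g G') {H : G.Subgraph} (hH : H.Connected) : (H.map f).Connected := by
  obtain ⟨⟨r, hr⟩, h⟩ := Subgraph.connected_iff_reflTransGen.1 hH
  refine Subgraph.connected_of_root (r := f r) ⟨r, hr, rfl⟩ ?_
  rintro _ ⟨x, hx, rfl⟩
  exact (h r hr x hx).lift f fun a b hab => ⟨a, b, hab, rfl, rfl⟩

lemma Iso.map_symm_map {V W : Type*} {G : SimpleGraph V} {G' : SimpleGraph W} (f : G ≃g G')
    (H : G.Subgraph) : (H.map f.toHom).map f.symm.toHom = H := by
  have h : f.symm.toHom.comp f.toHom = Hom.id := by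
    ext x
    exact f.symm_apply_apply x
  rw [← Subgraph.map_comp, h, Subgraph.map_id]

/-- The core index is invariant under isomorphisms. -/
lemma Iso.coreIndex_eq {V W : Type*} {G : SimpleGraph V} {G' : SimpleGraph W} (f : G ≃g G') :
    G.coreIndex = G'.coreIndex := by
  have himg : {H : G'.Subgraph | H.Connected} =
      (fun H : G.Subgraph => H.map f.toHom) '' {H | H.Connected} := by
    ext H
    constructor
    · intro hH
      exact ⟨H.map f.symm.toHom, hH.map_hom f.symm.toHom, f.symm.map_symm_map H⟩
    · rintro ⟨K, hK, rfl⟩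
      exact hK.map_hom f.toHom
  rw [coreIndex, coreIndex, himg, Set.ncard_image_of_injective]
  exact Function.LeftInverse.injective f.map_symm_map

end SimpleGraph

theorem theorem4p7 (n g : ℕ) (hg : 3 ≤ g) (hgn : g < n) :
    (SimpleGraph.lollipop n g).IsUnicyclicWithGirth n g ∧
    (∀ (V : Type*) [Finite V] (G : SimpleGraph V), G.IsUnicyclicWithGirth n g →
      (SimpleGraph.lollipop n g).coreIndex ≤ G.coreIndex ∧
      (G.coreIndex = (SimpleGraph.lollipop n g).coreIndex ↔
        Nonempty (G ≃g SimpleGraph.lollipop n g))) ∧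
    ((SimpleGraph.lollipop n g).coreIndex : ℚ) =
      (((n : ℚ) - (g : ℚ)) / 2) * ((n : ℚ) + (g : ℚ) ^ 2 + 3) + (g : ℚ) ^ 2 + 1 := by
  refine ⟨SimpleGraph.isUnicyclicWithGirth_lollipop hg hgn, ?_, ?_⟩
  · intro V _ G hG
    have : NeZero g := ⟨by omega⟩
    obtain ⟨p, hp, m, hm, hgrow⟩ := hG.exists_leafGrowth hg
    obtain ⟨h1, h2⟩ := hgrow.lollipopCount_le hg hp
    rw [← SimpleGraph.coreIndex_eq_ncard_connectedIn_univ] at h1 h2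
    rw [SimpleGraph.coreIndex_lollipop hg hgn hm]
    refine ⟨h1, fun he => ?_, fun ⟨f⟩ => ?_⟩
    · obtain ⟨q, hq⟩ := h2 he
      rw [hm] at hq
      exact hq.nonempty_iso hg
    · rw [f.coreIndex_eq, SimpleGraph.coreIndex_lollipop hg hgn hm]
  · obtain ⟨m, rfl⟩ := Nat.exists_eq_add_of_le hgn.le
    rw [SimpleGraph.coreIndex_lollipop hg hgn rfl, SimpleGraph.lollipopCount_cast]
    push_cast
    ring
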